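/- **Setting.** Let $n\ge 0$, let $K\in L^1(\mathbb{R}^n)$ be a real-valued kernel and let $G:\mathbb{R}\to\mathbb{R}$ be bounded and Lipschitz. Let $M=\mathcal{B}(\mathbb{R}^n,[0,1])$ be the set of Lebesgue measurable functions $f:\mathbb{R}^n\to[0,1]$ (functions, not classes), with the metric $d_\infty(f,g)=\sup_x|f(x)-g(x)|$. The Lenia arc field on $M$ is $$X_h(f)(x)=\min\bigl\{\max\{f(x)+h\,G((K*f)(x)),\,0\},\,1\bigr\},\qquad (K*f)(x)=\int_{\mathbb{R}^n}K(x-y)f(y)\,dy .$$ The Lenia flow is the forward flow $F$ on $M$ (that is, $(t,f)\mapsto F_t(f)$ is continuous on $[0,\infty)\times M$, $F_0(f)=f$ and $F_t(F_s(f))=F_{s+t}(f)$) that is forward tangent to $X$: $$\lim_{h\to0^+}\frac{d_\infty\bigl(F_{t+h}(f),X_h(F_t(f))\bigr)}{h}=0\quad\text{for all } t\ge 0,\ f\in M .$$ For $f_0\in M$ the Lenia solution with initial condition $f_0$ is $f_t:=F_t(f_0)$. **Proposition (finite propagation speed of the support).** Assume that there is $a>0$ such that $G(u)\le 0$ whenever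 $|u|\le a$, let $g>0$ be a finite upper bound for $G$, and assume that $K$ vanishes outside the open Euclidean ball $B(0,R)\subseteq\mathbb{R}^n$ of radius $R>0$. For $x\in\mathbb{R}^n$ let $$d(x):=\inf\{\|x-y\|_2 : y\in\operatorname{supp}(f_0)\}\in[0,\infty]$$ be the distance from $x$ to the support of $f_0$ (with $d(x)=\infty$ if $f_0=0$). Then $$f_t(x)=0\qquad\text{for every } t \text{ with } 0<t\le\frac{a\lfloor d(x)/R\rfloor}{g\,\|K\|_1}.$$ Here the bound is computed in $[0,\infty]$, with $\lfloor\infty\rfloor=\infty$ and, if $\|K\|_1=0$, with $k/0=\infty$ for $k>0$ and $0/0=0$. -/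

import Mathlib

open MeasureTheory Filter Topology
open scoped NNReal ENNReal

/-! ## Forward flows on metric spaces -/

/-- A forward flow on a metric space `M`: a jointly continuous map `(t, f) ↦ F t f`, for `t ≥ 0`,
with `F 0 f = f` and `F t (F s f) = F (s + t) f`. -/
structure IsForwardFlow {M : Type*} [MetricSpace M] (F : ℝ≥0 → M → M) : Prop where
  continuous : Continuous (fun p : ℝ≥0 × M => F p.1 p.2)
  zero : ∀ f : M, F 0 f = f
  add : ∀ (s t : ℝ≥0) (f : M), F t (F s f) = F (s + t) f

/-- `F` is forward tangent to the arc field `X`: for all `t ≥ 0` and all `f`,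
`d (F_{t+h} f, X_h (F_t f)) / h → 0` as `h → 0⁺`. Only the values of `X` at times `h` close to `0`
matter. -/
def IsForwardTangent {M : Type*} [MetricSpace M] (F X : ℝ≥0 → M → M) : Prop :=
  ∀ (t : ℝ≥0) (f : M),
    Tendsto (fun h : ℝ≥0 => dist (F (t + h) f) (X h (F t f)) / (h : ℝ)) (𝓝[>] 0) (𝓝 0)

/-! ## The state space of Lenia -/

/-- The set `𝓑(ℝⁿ, [0,1])` of Lebesgue measurable functions on Euclidean `n`-space with values in
`[0,1]`: genuine functions, not classes up to null sets. (`NullMeasurable f volume` is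
measurability for the completion of the Borel sigma-algebra under Lebesgue measure.) -/
structure LeniaState (n : ℕ) where
  toFun : EuclideanSpace ℝ (Fin n) → ℝ
  nullMeasurable' : NullMeasurable toFun volume
  mem_Icc' : ∀ x, toFun x ∈ Set.Icc (0 : ℝ) 1

namespace LeniaState

variable {n : ℕ}

instance : CoeFun (LeniaState n) (fun _ => EuclideanSpace ℝ (Fin n) → ℝ) := ⟨toFun⟩

@[ext] theorem ext {f g : LeniaState n} (h : ∀ x, f x = g x) : f = g := by
  cases f
  cases g
  congr
  exact funext h

theorem abs_sub_le_one (f g : LeniaState n) (x : EuclideanSpace ℝ (Fin n)) :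
    |f x - g x| ≤ 1 := by
  have hf := f.mem_Icc' x
  have hg := g.mem_Icc' x
  rw [abs_le]
  constructor <;> linarith [hf.1, hf.2, hg.1, hg.2]

theorem bddAbove_abs_sub (f g : LeniaState n) :
    BddAbove (Set.range fun x => |f x - g x|) := by
  refine ⟨1, ?_⟩
  rintro _ ⟨x, rfl⟩
  exact abs_sub_le_one f g x

/-- The supremum metric `d_∞(f, g) = sup_x |f x - g x|`. -/
noncomputable instance : MetricSpace (LeniaState n) where
  dist f g := ⨆ x, |f x - g x|
  dist_self f := by simp
  dist_comm f g := by simp only [abs_sub_comm]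
  dist_triangle f g h := by
    refine ciSup_le fun x => ?_
    exact (abs_sub_le (f x) (g x) (h x)).trans
      (add_le_add (le_ciSup (bddAbove_abs_sub f g) x) (le_ciSup (bddAbove_abs_sub g h) x))
  eq_of_dist_eq_zero := by
    intro f g h
    refine ext fun x => ?_
    have h1 : |f x - g x| ≤ 0 := h ▸ le_ciSup (bddAbove_abs_sub f g) x
    exact sub_eq_zero.mp (abs_nonpos_iff.mp h1)

theorem dist_def (f g : LeniaState n) : dist f g = ⨆ x, |f x - g x| := rfl

end LeniaState

/-! ## The Lenia arc field and its flow -/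

/-- The convolution `(K ∗ f)(x) = ∫ K (x - y) f(y) dy` over `ℝⁿ`. -/
noncomputable def leniaConv {n : ℕ} (K f : EuclideanSpace ℝ (Fin n) → ℝ)
    (x : EuclideanSpace ℝ (Fin n)) : ℝ :=
  ∫ y, K (x - y) * f y

theorem aestronglyMeasurable_leniaConv {n : ℕ} {K f : EuclideanSpace ℝ (Fin n) → ℝ}
    (hK : AEStronglyMeasurable K volume) (hf : NullMeasurable f volume) :
    AEStronglyMeasurable (leniaConv K f) volume := by
  have h := hf.aemeasurable.aestronglyMeasurable.convolution_integrand
    (ContinuousLinearMap.mul ℝ ℝ) hK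
  have h2 := h.integral_prod_right'
  refine h2.congr (Eventually.of_forall fun x => ?_)
  simp [leniaConv, mul_comm]

/-- The Lenia arc field `X_t(f)(x) = [f(x) + t G((K ∗ f)(x))]₀¹`, where
`[u]₀¹ = min (max u 0) 1` is the clip to `[0,1]`, on `𝓑(ℝⁿ, [0,1])`. -/
noncomputable def leniaArcField {n : ℕ} {G : ℝ → ℝ} {K : EuclideanSpace ℝ (Fin n) → ℝ}
    (hG : Continuous G) (hK : Integrable K volume) (t : ℝ≥0) (f : LeniaState n) :
    LeniaState n where
  toFun x := min (max (f x + t * G (leniaConv K f x)) 0) 1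
  nullMeasurable' := by
    have h1 : AEMeasurable f volume := f.nullMeasurable'.aemeasurable
    have h2 : AEMeasurable (fun x => G (leniaConv K f x)) volume :=
      (hG.comp_aestronglyMeasurable
        (aestronglyMeasurable_leniaConv hK.1 f.nullMeasurable')).aemeasurable
    exact (((h1.add (h2.const_mul (t : ℝ))).max aemeasurable_const).min
      aemeasurable_const).nullMeasurable
  mem_Icc' x := ⟨le_min (le_max_right _ _) zero_le_one, min_le_right _ _⟩

/-- `F` is the Lenia flow with activation function `G` and kernel `K`: the forward flow on
`𝓑(ℝⁿ, [0,1])` that is forward tangent to the Lenia arc field. The Lenia solution with initial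
condition `f₀` is `f_t = F t f₀`. -/
structure IsLeniaFlow {n : ℕ} {G : ℝ → ℝ} {K : EuclideanSpace ℝ (Fin n) → ℝ}
    (hG : Continuous G) (hK : Integrable K volume)
    (F : ℝ≥0 → LeniaState n → LeniaState n) : Prop where
  isForwardFlow : IsForwardFlow F
  isForwardTangent : IsForwardTangent F (leniaArcField hG hK)

namespace LeniaState

variable {n : ℕ}

/-! Mass reaches a point only after its `R`-neighbourhood has filled enough to push `|K ∗ f|` above
`a`, and filling takes time because growth is at most `g` per unit time. Cut `[0, t]` into `k` steps
of length `τ` with `g τ ‖K‖₁ ≤ a`, and induct on `k`. If `x` is at distance at least `(k + 1) R`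
from the support, each `y` in `B(x, R)` is at distance more than `k R`, so it stays at zero until `k
τ` and is at most `g τ` until `(k + 1) τ`. Hence `|(K ∗ f_s)(x)| ≤ a` (`abs_leniaConv_le`), so `G ≤
0` there and `x` cannot leave zero. Tangency becomes pointwise growth bounds in `apply_le_add_mul`,
used with rate `g` at `y` and rate `0` at `x`. -/

theorem abs_sub_le_dist (f g : LeniaState n) (x : EuclideanSpace ℝ (Fin n)) :
    |f x - g x| ≤ dist f g :=
  le_ciSup (bddAbove_abs_sub f g) x

theorem continuous_apply (x : EuclideanSpace ℝ (Fin n)) :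
    Continuous fun f : LeniaState n => f x := by
  refine (LipschitzWith.of_dist_le_mul (K := 1) fun f g => ?_).continuous
  simpa [Real.dist_eq] using abs_sub_le_dist f g x

end LeniaState

/-- If `f` takes values in `[0, c]` on the ball `B(x, R)` and `K` is supported in `B(0, R)`, then
`|(K ∗ f)(x)| ≤ c ‖K‖₁`. -/
theorem abs_leniaConv_le {n : ℕ} {K f : EuclideanSpace ℝ (Fin n) → ℝ} (hK : Integrable K volume)
    {R : ℝ} (hKR : Function.support K ⊆ Metric.ball 0 R) (x : EuclideanSpace ℝ (Fin n)) {c : ℝ}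
    (hf₀ : ∀ y, 0 ≤ f y) (hf : ∀ y, dist x y < R → f y ≤ c) :
    |leniaConv K f x| ≤ c * ∫ y, ‖K y‖ := by
  have hint : Integrable (fun y => c * ‖K (x - y)‖) volume :=
    (hK.comp_sub_left x).norm.const_mul c
  calc |leniaConv K f x| = ‖∫ y, K (x - y) * f y‖ := (Real.norm_eq_abs _).symm
    _ ≤ ∫ y, c * ‖K (x - y)‖ := by
        refine norm_integral_le_of_norm_le hint (Eventually.of_forall fun y => ?_)
        by_cases hy : K (x - y) = 0
        · simp [hy]
        · have hxy : dist x y < R := by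
            simpa [dist_eq_norm] using hKR (Function.mem_support.mpr hy)
          rw [norm_mul, Real.norm_of_nonneg (hf₀ y), mul_comm]
          exact mul_le_mul_of_nonneg_right (hf y hxy) (norm_nonneg _)
    _ = c * ∫ y, ‖K y‖ := by
        rw [integral_const_mul, integral_sub_left_eq_self (fun y => ‖K y‖) volume x]

namespace IsLeniaFlow

variable {n : ℕ} {G : ℝ → ℝ} {K : EuclideanSpace ℝ (Fin n) → ℝ} {hG : Continuous G}
  {hK : Integrable K volume} {F : ℝ≥0 → LeniaState n → LeniaState n}

/-- A Lenia solution grows at a point `x` at rate at most `c ≥ 0` as long as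
`G ((K ∗ f_s)(x)) ≤ c`. -/
theorem apply_le_add_mul (hF : IsLeniaFlow hG hK F) (f : LeniaState n)
    (x : EuclideanSpace ℝ (Fin n)) {p q : ℝ≥0} (hpq : p ≤ q) {c : ℝ} (hc : 0 ≤ c)
    (h : ∀ s : ℝ≥0, p ≤ s → s < q → G (leniaConv K (F s f) x) ≤ c) :
    F q f x ≤ F p f x + c * (q - p) := by
  have hcont : Continuous fun s : ℝ => F s.toNNReal f x :=
    (LeniaState.continuous_apply x).comp
      (hF.isForwardFlow.continuous.comp (continuous_real_toNNReal.prodMk continuous_const))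
  -- Comparison with a line of slope `c`: continuity suffices, together with right slopes that are
  -- frequently below each `r > c`. Differentiability in time is not needed.
  have key := image_le_of_liminf_slope_right_le_deriv_boundary
    (f := fun s : ℝ => F s.toNNReal f x) (a := p) (b := q) hcont.continuousOn
    (B := fun s => F p f x + c * (s - p)) (B' := fun _ => c) (by simp)
    (by fun_prop)
    (fun s _ => by
      simpa using ((((hasDerivAt_id s).sub_const (p : ℝ)).const_mul c).const_add
        (F p f x)).hasDerivWithinAt)
    ?_ (Set.right_mem_Icc.mpr (NNReal.coe_le_coe.mpr hpq))
  · simpa using key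
  rintro s ⟨hps, hsq⟩ r hr
  lift s to ℝ≥0 using p.coe_nonneg.trans hps
  have hGs := h s (NNReal.coe_le_coe.mp hps) (NNReal.coe_lt_coe.mp hsq)
  have hlim : Tendsto (fun z : ℝ => (z - s).toNNReal) (𝓝[>] (s : ℝ)) (𝓝[>] 0) := by
    refine tendsto_nhdsWithin_iff.mpr ⟨?_, ?_⟩
    · have : Continuous fun z : ℝ => (z - s).toNNReal := by fun_prop
      simpa using (this.tendsto (s : ℝ)).mono_left nhdsWithin_le_nhds
    · filter_upwards [self_mem_nhdsWithin] with z hz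
      simpa using hz
  have hev := ((hF.isForwardTangent s f).comp hlim).eventually_lt_const (sub_pos.mpr hr)
  refine Eventually.frequently ?_
  filter_upwards [hev, self_mem_nhdsWithin] with z hz hsz
  have hsz' : 0 < z - s := sub_pos.mpr hsz
  have hadd : s + (z - s).toNNReal = z.toNNReal := by
    rw [← NNReal.coe_inj, NNReal.coe_add, Real.coe_toNNReal _ hsz'.le,
      Real.coe_toNNReal _ (s.coe_nonneg.trans (le_of_lt hsz))]
    ring
  simp only [Function.comp_apply, hadd] at hz
  rw [Real.coe_toNNReal _ hsz'.le, div_lt_iff₀ hsz'] at hz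
  have h1 := (le_abs_self _).trans (LeniaState.abs_sub_le_dist (F z.toNNReal f)
    (leniaArcField hG hK (z - s).toNNReal (F s f)) x)
  have h2 : leniaArcField hG hK (z - s).toNNReal (F s f) x ≤ F s f x + (z - s) * c := by
    -- Clipping at `1` only lowers the value; clipping at `0` is harmless because `c ≥ 0`.
    refine (min_le_left _ _).trans (max_le ?_ ?_)
    · rw [Real.coe_toNNReal _ hsz'.le]
      gcongr
    · exact add_nonneg ((F s f).mem_Icc' x).1 (mul_nonneg hsz'.le hc)
  rw [slope_def_field, div_lt_iff₀ hsz', Real.toNNReal_coe]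
  linarith

/-- The support of a Lenia solution propagates by at most `R` in any time `τ` with
`g τ ‖K‖₁ ≤ a`. -/
theorem apply_eq_zero_of_le_infEDist (hF : IsLeniaFlow hG hK F) {a g R : ℝ}
    (hGa : ∀ u : ℝ, |u| ≤ a → G u ≤ 0) (hg : 0 < g) (hGg : ∀ u : ℝ, G u ≤ g)
    (hKR : Function.support K ⊆ Metric.ball 0 R) (f₀ : LeniaState n) {τ : ℝ≥0}
    (hτ : g * τ * ∫ y, ‖K y‖ ≤ a) (k : ℕ) (x : EuclideanSpace ℝ (Fin n))
    (hx₀ : 0 < Metric.infEDist x (tsupport f₀))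
    (hx : k * ENNReal.ofReal R ≤ Metric.infEDist x (tsupport f₀)) (t : ℝ≥0) (ht : t ≤ k * τ) :
    F t f₀ x = 0 := by
  have hzero : ∀ y, 0 < Metric.infEDist y (tsupport f₀) → F 0 f₀ y = 0 := fun y hy => by
    rw [hF.isForwardFlow.zero]
    exact image_eq_zero_of_notMem_tsupport
      fun hmem => hy.ne' (Metric.infEDist_zero_of_mem hmem)
  induction k generalizing x t with
  | zero =>
    obtain rfl : t = 0 := by simpa using ht
    exact hzero x hx₀
  | succ k ih =>
    -- Growth rate `0` on all of `[0, t]`, since `G` is evaluated where its argument is at most `a`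
    -- in absolute value.
    have hdecr : F t f₀ x ≤ F 0 f₀ x + 0 * ((t : ℝ) - (0 : ℝ≥0)) := by
      refine hF.apply_le_add_mul f₀ x t.2 le_rfl fun s _ hst => hGa _ ?_
      refine (abs_leniaConv_le hK hKR x (c := g * τ) (fun y => ((F s f₀).mem_Icc' y).1)
        fun y hxy => ?_).trans hτ
      have hxy' : edist x y < ENNReal.ofReal R := by
        rw [edist_dist]
        exact (ENNReal.ofReal_lt_ofReal_iff_of_nonneg dist_nonneg).mpr hxy
      -- Strictness comes from the open ball; it gives the positive distance that the induction
      -- hypothesis needs even for `k = 0`.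
      have hy : k * ENNReal.ofReal R < Metric.infEDist y (tsupport f₀) := by
        have h1 : k * ENNReal.ofReal R + ENNReal.ofReal R
            ≤ Metric.infEDist y (tsupport f₀) + edist x y := by
          refine le_trans ?_ (hx.trans Metric.infEDist_le_infEDist_add_edist)
          push_cast
          rw [add_mul, one_mul]
        -- The distance may be `∞`, where addition is not strictly monotone; the negated goal makes
        -- it finite.
        by_contra! hle
        have hfin : k * ENNReal.ofReal R ≠ ⊤ := by finiteness
        exact absurd h1 (not_le.mpr (ENNReal.add_lt_add_of_le_of_lt
          (ne_top_of_le_ne_top hfin hle) hle hxy'))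
      have hy₀ := zero_le.trans_lt hy
      rcases le_total s (k * τ) with hs | hs
      · rw [ih y hy₀ hy.le s hs]
        positivity
      · have hgrow := hF.apply_le_add_mul f₀ y hs hg.le fun _ _ _ => hGg _
        rw [ih y hy₀ hy.le _ le_rfl, zero_add] at hgrow
        refine hgrow.trans (mul_le_mul_of_nonneg_left ?_ hg.le)
        have hsτ : (s : ℝ) ≤ (k + 1) * τ := by exact_mod_cast hst.le.trans ht
        push_cast
        linarith
    rw [hzero x hx₀, zero_mul, add_zero] at hdecr
    exact le_antisymm hdecr ((F t f₀).mem_Icc' x).1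

end IsLeniaFlow

/-- A positive time below `a m / (g N)`, with `m ∈ [0, ∞]` an extended natural number, is below
`a k / (g N)` for some positive natural number `k ≤ m`. -/
theorem exists_nat_of_le_mul_div {m : ℕ∞} {a g N : ℝ} (ha : 0 < a) (hg : 0 < g)
    {t : ℝ≥0} (ht : 0 < t)
    (h : (t : ℝ≥0∞) ≤ ENNReal.ofReal a * (m : ℝ≥0∞) / (ENNReal.ofReal g * ENNReal.ofReal N)) :
    ∃ k : ℕ, 0 < k ∧ (k : ℕ∞) ≤ m ∧ g * t * N ≤ k * a := by
  induction m using ENat.recTopCoe with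
  | top =>
    -- With an infinite floor any large `k` works; adding `1` below keeps it positive.
    obtain ⟨k, hk⟩ := exists_nat_ge (g * t * N / a)
    refine ⟨k + 1, k.succ_pos, le_top, ?_⟩
    rw [div_le_iff₀ ha] at hk
    push_cast
    linarith
  | coe k =>
    have hk : 0 < k := by
      -- For `k = 0` the bound is `0`, also when `N = 0` by `0 / 0 = 0`, contradicting `t > 0`.
      rcases Nat.eq_zero_or_pos k with rfl | hk
      · simp [ht.ne'] at h
      · exact hk
    refine ⟨k, hk, le_rfl, ?_⟩
    have h1 := ENNReal.mul_le_of_le_div h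
    rw [ENat.toENNReal_coe, ← ENNReal.ofReal_natCast k, ← ENNReal.ofReal_coe_nnreal,
      ← ENNReal.ofReal_mul hg.le, ← ENNReal.ofReal_mul t.coe_nonneg, ← ENNReal.ofReal_mul ha.le,
      ENNReal.ofReal_le_ofReal_iff (by positivity)] at h1
    linarith

/-- The distance `d(x)` from `x` to `supp f₀` is taken in `[0, ∞]`, so it is `∞` when `f₀ = 0`; the
bound on `t` is likewise computed in `[0, ∞]`, with `k / 0 = ∞` for `k > 0` and `0 / 0 = 0`. -/
theorem mainTheorem5 (n : ℕ) (G : ℝ → ℝ) (K : EuclideanSpace ℝ (Fin n) → ℝ)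
    (C : ℝ≥0) (hG : LipschitzWith C G) (hGbdd : ∃ B : ℝ, ∀ u, |G u| ≤ B)
    (hK : Integrable K volume)
    (F : ℝ≥0 → LeniaState n → LeniaState n) (hF : IsLeniaFlow hG.continuous hK F)
    (a : ℝ) (ha : 0 < a) (hGa : ∀ u : ℝ, |u| ≤ a → G u ≤ 0)
    (g : ℝ) (hg : 0 < g) (hGg : ∀ u : ℝ, G u ≤ g)
    (R : ℝ) (hR : 0 < R) (hKR : Function.support K ⊆ Metric.ball 0 R)
    (f₀ : LeniaState n) (x : EuclideanSpace ℝ (Fin n)) (t : ℝ≥0) (ht : 0 < t)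
    (htx : (t : ℝ≥0∞) ≤
      ENNReal.ofReal a * ((⌊Metric.infEDist x (tsupport f₀) / ENNReal.ofReal R⌋ₑ : ℕ∞) : ℝ≥0∞)
        / (ENNReal.ofReal g * eLpNorm K 1 volume)) :
    F t f₀ x = 0 := by
  rw [eLpNorm_one_eq_lintegral_enorm, ← ofReal_integral_norm_eq_lintegral_enorm hK] at htx
  obtain ⟨k, hk, hkm, hkt⟩ := exists_nat_of_le_mul_div ha hg ht htx
  have hR₀ : ENNReal.ofReal R ≠ 0 := (ENNReal.ofReal_pos.mpr hR).ne'
  have hkx : k * ENNReal.ofReal R ≤ Metric.infEDist x (tsupport f₀) :=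
    (ENNReal.le_div_iff_mul_le (Or.inl hR₀) (Or.inl ENNReal.ofReal_ne_top)).mp
      (by simpa using ENat.le_floor.mp hkm)
  have hk₀ : (0 : ℝ) < k := Nat.cast_pos.mpr hk
  -- Equal steps `t / k` turn `g t ‖K‖₁ ≤ k a` into the one-step condition; `k > 0` makes the
  -- distance to the support positive.
  refine hF.apply_eq_zero_of_le_infEDist (τ := t / k) (a := a) hGa hg hGg hKR f₀ ?_ k x
    (lt_of_lt_of_le (by positivity) hkx) hkx t ?_
  · rw [NNReal.coe_div, NNReal.coe_natCast, mul_div_assoc', div_mul_eq_mul_div,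
      div_le_iff₀ hk₀, mul_comm a]
    exact hkt
  · rw [mul_div_cancel₀]
    exact_mod_cast hk.ne'
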